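/- Let $0<p<1$ and define $F_3\colon (0,\infty)\times(0,\infty)\times(0,\infty)\to\mathbb{R}$ by \[ F_3(t_1,t_2,t_3)=\begin{cases}\dfrac{t_1^{1-p}-t_2^{1-p}}{t_1-t_2}\,t_3^{1+p}, & t_1\neq t_2,\\[2ex] (1-p)\,t_1^{-p}\,t_3^{1+p}, & t_1=t_2.\end{cases} \] Then: 1. $F_3$ may be extended to a convex map in positive definite invertible operators. That is, for every complex Hilbert space $\mathcal H$ there is a map $\Phi$ that sends each triple $(A,B,C)$ of positive definite invertible operators in $B(\mathcal H)$ to a self-adjoint operator $\Phi(A,B,C)\in B(\mathcal H)$, such that $\Phi(A,B,C)=F_3(A,B,C)$ (functional calculus) whenever $A,B,C$ commute with each other, and such that \[ \Phi(\lambda X+(1-\lambda)Y)\le\lambda\,\Phi(X)+(1-\lambda)\,\Phi(Y) \] for all triples $X,Y$ of positive definite invertible operators and all $\lambda\in[0,1]$, where $\le$ is the order of self-adjoint operators. 2. In particular, $F_3$ is operator convex: for every complex Hilbert space $\mathcal H$ and all mutually commuting $C^*$-subalgebras $\mathcal A_1,\mathcal A_2,\mathcal A_3$ of $B(\mathcal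 H)$, the functional calculus satisfies \[ F_3(\lambda X_1+(1-\lambda)Y_1,\dots,\lambda X_3+(1-\lambda)Y_3)\le \lambda F_3(X_1,X_2,X_3)+(1-\lambda)F_3(Y_1,Y_2,Y_3) \] for all self-adjoint $X_i,Y_i\in\mathcal A_i$ with spectra in $(0,\infty)$ and all $\lambda\in[0,1]$. -/

import Mathlib

universe u

section JointFunctionalCalculus

variable {k : ℕ} {H : Type u} [NormedAddCommGroup H] [InnerProductSpace ℂ H] [CompleteSpace H]

/-- The product `σ(X₁) × ⋯ × σ(X_k)` of the spectra of a tuple of operators. -/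
def spectralBox (X : Fin k → H →L[ℂ] H) : Set (Fin k → ℝ) :=
  Set.univ.pi fun i => spectrum ℝ (X i)

/-- The coordinate function `x ↦ xᵢ` on the product of the spectra. -/
def spectralCoord (X : Fin k → H →L[ℂ] H) (i : Fin k) : C(spectralBox X, ℝ) where
  toFun x := x.1 i
  continuous_toFun := (continuous_apply i).comp continuous_subtype_val

/-- A continuous unital `*`-homomorphism `Ψ` from the continuous functions on the product of the
spectra of `X₁, …, X_k` to `B(H)` with `Ψ(xᵢ) = Xᵢ`. For commuting self-adjoint operators exactly
one exists (see below), and `f(X₁, …, X_k)` is `Ψ(f)`; if `Xₘ = ∑ⱼ λⱼ(m) Pⱼ(m)` are spectral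
resolutions, then `Ψ(f) = ∑ f(λ_{j₁}(1), …, λ_{j_k}(k)) P_{j₁}(1) ⋯ P_{j_k}(k)`. -/
def IsJointCalculus (X : Fin k → H →L[ℂ] H)
    (Ψ : C(spectralBox X, ℝ) →⋆ₐ[ℝ] (H →L[ℂ] H)) : Prop :=
  Continuous Ψ ∧ ∀ i, Ψ (spectralCoord X i) = X i

open Classical in
/-- The functional calculus `f(X₁, …, X_k)` of a tuple of commuting self-adjoint operators, for a
real function `f` that is continuous on the product of their spectra (junk value `0` in all other
cases). -/
noncomputable def jointCalculus (f : (Fin k → ℝ) → ℝ) (X : Fin k → H →L[ℂ] H) : H →L[ℂ] H :=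
  if h : (∃ Ψ, IsJointCalculus X Ψ) ∧ ContinuousOn f (spectralBox X) then
    h.1.choose ⟨(spectralBox X).domRestrict f, h.2.domRestrict⟩
  else 0

theorem spectralBox_isCompact (X : Fin k → H →L[ℂ] H) : IsCompact (spectralBox X) :=
  isCompact_univ_pi fun i => spectrum.isCompact (X i)

/-- Uniqueness of the joint functional calculus. -/
theorem IsJointCalculus.unique {X : Fin k → H →L[ℂ] H}
    {Ψ₁ Ψ₂ : C(spectralBox X, ℝ) →⋆ₐ[ℝ] (H →L[ℂ] H)}
    (h₁ : IsJointCalculus X Ψ₁) (h₂ : IsJointCalculus X Ψ₂) : Ψ₁ = Ψ₂ := by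
  have : CompactSpace (spectralBox X) := isCompact_iff_compactSpace.mp (spectralBox_isCompact X)
  let S : Subalgebra ℝ C(spectralBox X, ℝ) := Algebra.adjoin ℝ (Set.range (spectralCoord X))
  have hsep : S.SeparatesPoints := by
    intro x y hxy
    obtain ⟨i, hi⟩ := Function.ne_iff.mp (fun h => hxy (Subtype.ext h))
    exact ⟨_, ⟨spectralCoord X i, Algebra.subset_adjoin ⟨i, rfl⟩, rfl⟩, hi⟩
  have htop := ContinuousMap.subalgebra_topologicalClosure_eq_top_of_separatesPoints S hsep
  have hS : ∀ g ∈ S, Ψ₁ g = Ψ₂ g := by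
    intro g hg
    induction hg using Algebra.adjoin_induction with
    | mem x hx => obtain ⟨i, rfl⟩ := hx; rw [h₁.2, h₂.2]
    | algebraMap r => exact (AlgHomClass.commutes Ψ₁ r).trans (AlgHomClass.commutes Ψ₂ r).symm
    | add x y _ _ hx hy => simp only [map_add, hx, hy]
    | mul x y _ _ hx hy => simp only [map_mul, hx, hy]
  have hcl : IsClosed {g | Ψ₁ g = Ψ₂ g} := isClosed_eq h₁.1 h₂.1
  have hd : closure (S : Set C(spectralBox X, ℝ)) = Set.univ := by
    rw [← Subalgebra.topologicalClosure_coe, htop]; rfl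
  ext1 g
  exact (closure_minimal hS hcl) (hd ▸ Set.mem_univ g)

/-- Existence of a joint functional calculus in a commutative `C*`-algebra. -/
theorem exists_jointCalculus_aux {S : Type*} [CommCStarAlgebra S] (Y : Fin k → S)
    (K : Set (Fin k → ℝ)) (hK : ∀ φ : WeakDual.characterSpace ℂ S,
      (∀ i, ((φ (Y i)).re : ℂ) = φ (Y i)) ∧ (fun i => (φ (Y i)).re) ∈ K) :
    ∃ Ψ : C(K, ℝ) →⋆ₐ[ℝ] S, Continuous Ψ ∧ ∀ (i) (g : C(K, ℝ)), (∀ x, g x = x.1 i) →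
      Ψ g = Y i := by
  let τ : C(WeakDual.characterSpace ℂ S, K) :=
    { toFun := fun φ => ⟨fun i => (φ (Y i)).re, (hK φ).2⟩
      continuous_toFun := by
        refine Continuous.subtype_mk (continuous_pi fun i => ?_) _
        exact Complex.continuous_re.comp
          (map_continuous (WeakDual.gelfandTransform ℂ S (Y i))) }
  let γ : C(WeakDual.characterSpace ℂ S, ℂ) ≃⋆ₐ[ℂ] S := (gelfandStarTransform S).symm
  let e : C(K, ℝ) → C(WeakDual.characterSpace ℂ S, ℂ) := fun g =>
    ⟨fun φ => ((g (τ φ) : ℝ) : ℂ), by fun_prop⟩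
  have he : Continuous e := by
    have h1 : Continuous fun g : C(K, ℝ) => g.comp τ :=
      ContinuousMap.continuous_precomp τ
    exact (ContinuousMap.continuous_postcomp
      (⟨fun r : ℝ => (r : ℂ), Complex.continuous_ofReal⟩ : C(ℝ, ℂ))).comp h1
  have hγ : Continuous γ := (gelfandTransform_isometry S).right_inv
    (gelfandStarTransform S).apply_symm_apply |>.continuous
  have e_one : e 1 = 1 := by ext φ; simp [e]
  have e_zero : e 0 = 0 := by ext φ; simp [e]
  have e_mul : ∀ f g, e (f * g) = e f * e g := fun f g => by ext φ; simp [e]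
  have e_add : ∀ f g, e (f + g) = e f + e g := fun f g => by ext φ; simp [e]
  have e_star : ∀ f, e (star f) = star (e f) := fun f => by ext φ; simp [e]
  have e_alg : ∀ r : ℝ, e (algebraMap ℝ _ r) = algebraMap ℂ _ (r : ℂ) := fun r => by
    ext φ; simp [e]
  refine ⟨{ toFun := fun g => γ (e g)
            map_one' := by rw [e_one, map_one]
            map_zero' := by rw [e_zero, map_zero]
            map_mul' := fun f g => by rw [e_mul, map_mul]
            map_add' := fun f g => by rw [e_add, map_add]
            map_star' := fun f => by rw [e_star, map_star]
            commutes' := fun r => by rw [e_alg, AlgHomClass.commutes γ]; rfl },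
    hγ.comp he, fun i g hg => ?_⟩
  have h3 : e g = gelfandStarTransform S (Y i) := by
    ext φ
    change ((g (τ φ) : ℝ) : ℂ) = φ (Y i)
    rw [hg]
    exact (hK φ).1 i
  change γ (e g) = Y i
  rw [h3]
  exact (gelfandStarTransform S).symm_apply_apply (Y i)

/-- Existence of the joint functional calculus of commuting self-adjoint operators. -/
theorem exists_isJointCalculus (X : Fin k → H →L[ℂ] H) (hsa : ∀ i, IsSelfAdjoint (X i))
    (hc : ∀ i j, Commute (X i) (X j)) : ∃ Ψ, IsJointCalculus X Ψ := by
  let S₀ : StarSubalgebra ℂ (H →L[ℂ] H) := StarAlgebra.adjoin ℂ (Set.range X)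
  have hS₀ : ∀ x y : S₀, x * y = y * x :=
    (StarAlgebra.isMulCommutative_adjoin ℂ (s := Set.range X)
      (by rintro _ ⟨i, rfl⟩ _ ⟨j, rfl⟩; exact hc i j)
      (by rintro _ ⟨i, rfl⟩ _ ⟨j, rfl⟩; rw [(hsa j).star_eq]; exact hc i j)).is_comm.comm
  let S : StarSubalgebra ℂ (H →L[ℂ] H) := S₀.topologicalClosure
  have hScl : IsClosed (S : Set (H →L[ℂ] H)) := S₀.isClosed_topologicalClosure
  let _ : CommCStarAlgebra S :=
    { (inferInstance : CStarAlgebra S) with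
      mul_comm := (S₀.commRingTopologicalClosure hS₀).mul_comm }
  have hmem : ∀ i, X i ∈ S := fun i =>
    S₀.le_topologicalClosure (StarAlgebra.subset_adjoin ℂ _ ⟨i, rfl⟩)
  let Y : Fin k → S := fun i => ⟨X i, hmem i⟩
  have hspec : ∀ (φ : WeakDual.characterSpace ℂ S) i, ((φ (Y i)).re : ℂ) = φ (Y i) ∧
      (φ (Y i)).re ∈ spectrum ℝ (X i) := by
    intro φ i
    have h1 : φ (Y i) ∈ spectrum ℂ (X i) := by
      have := AlgHom.apply_mem_spectrum φ (Y i)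
      rwa [StarSubalgebra.spectrum_eq (hS := hScl)] at this
    have h2 : ((φ (Y i)).re : ℂ) = φ (Y i) := ((hsa i).mem_spectrum_eq_re h1).symm
    refine ⟨h2, ?_⟩
    rw [← spectrum.algebraMap_mem_iff ℂ]
    simpa [h2] using h1
  obtain ⟨Ψ, hΨ, hΨ'⟩ := exists_jointCalculus_aux Y (spectralBox X)
    fun φ => ⟨fun i => (hspec φ i).1, fun i _ => (hspec φ i).2⟩
  exact ⟨(S.subtype.restrictScalars ℝ).comp Ψ, continuous_subtype_val.comp hΨ,
    fun i => congrArg Subtype.val (hΨ' i (spectralCoord X i) fun _ => rfl)⟩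

/-- `f(X₁, …, X_k)` is the value at `f` of the joint functional calculus. -/
theorem IsJointCalculus.jointCalculus_eq {X : Fin k → H →L[ℂ] H}
    {Ψ : C(spectralBox X, ℝ) →⋆ₐ[ℝ] (H →L[ℂ] H)} (hΨ : IsJointCalculus X Ψ)
    {f : (Fin k → ℝ) → ℝ} (hf : ContinuousOn f (spectralBox X)) :
    jointCalculus f X = Ψ ⟨(spectralBox X).domRestrict f, hf.domRestrict⟩ := by
  have h : (∃ Ψ, IsJointCalculus X Ψ) ∧ ContinuousOn f (spectralBox X) := ⟨⟨Ψ, hΨ⟩, hf⟩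
  rw [jointCalculus, dif_pos h, h.1.choose_spec.unique hΨ]

end JointFunctionalCalculus

/-- A real function `f` on a product `I₁ × ⋯ × I_k` of real intervals is operator convex if, for
all Hilbert spaces `H` and all mutually commuting `C*`-subalgebras `𝒜₁, …, 𝒜_k` of `B(H)`, the
functional calculus `(X₁, …, X_k) ↦ f(X₁, …, X_k)` is convex on the tuples of self-adjoint
`Xᵢ ∈ 𝒜ᵢ` with spectra in `Iᵢ`. -/
def IsOperatorConvex {k : ℕ} (I : Fin k → Set ℝ) (f : (Fin k → ℝ) → ℝ) : Prop :=
  ∀ (H : Type u) [NormedAddCommGroup H] [InnerProductSpace ℂ H] [CompleteSpace H]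
    (𝒜 : Fin k → NonUnitalStarSubalgebra ℂ (H →L[ℂ] H)),
    (∀ i, IsClosed (𝒜 i : Set (H →L[ℂ] H))) →
    (∀ i j, i ≠ j → ∀ a ∈ 𝒜 i, ∀ b ∈ 𝒜 j, Commute a b) →
    ConvexOn ℝ {X : Fin k → H →L[ℂ] H |
      ∀ i, X i ∈ 𝒜 i ∧ IsSelfAdjoint (X i) ∧ spectrum ℝ (X i) ⊆ I i} (jointCalculus f)

/-- The `k`-tuples of positive definite invertible operators on `H`. -/
def posDefTuples (k : ℕ) (H : Type u) [NormedAddCommGroup H] [InnerProductSpace ℂ H] :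
    Set (Fin k → H →L[ℂ] H) :=
  {A | ∀ i, IsStrictlyPositive (A i)}

/-- `Φ` is an extension of the real function `f` on `(0, ∞)ᵏ` to `k`-tuples of (not necessarily
commuting) positive definite invertible operators: its values are self-adjoint, and on commuting
tuples it is the functional calculus by `f`. -/
def IsOperatorExtension {k : ℕ} {H : Type u} [NormedAddCommGroup H] [InnerProductSpace ℂ H]
    [CompleteSpace H] (f : (Fin k → ℝ) → ℝ) (Φ : (Fin k → H →L[ℂ] H) → H →L[ℂ] H) : Prop :=
  (∀ A ∈ posDefTuples k H, IsSelfAdjoint (Φ A)) ∧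
    ∀ A ∈ posDefTuples k H, (∀ i j, Commute (A i) (A j)) → Φ A = jointCalculus f A

/-- The function `(t₁, t₂, t₃) ↦ (t₁^{1-p} - t₂^{1-p}) / (t₁ - t₂) · t₃^{1+p}`, with the difference
quotient replaced by the derivative `(1-p) t₁^{-p}` for `t₁ = t₂`. -/
noncomputable def F₃ (p : ℝ) (t : Fin 3 → ℝ) : ℝ :=
  if t 0 = t 1 then (1 - p) * t 0 ^ (-p) * t 2 ^ (1 + p)
  else (t 0 ^ (1 - p) - t 1 ^ (1 - p)) / (t 0 - t 1) * t 2 ^ (1 + p)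

/-!
The identities
`(t₁ ^ (1 - p) - t₂ ^ (1 - p)) / (t₁ - t₂) = (1 - p) ∫₀¹ (l t₁ + (1 - l) t₂) ^ (-p) dl` and
`m ^ (-p) t ^ (1 + p) = κ⁻¹ ∫₀^∞ s ^ (-p) t (m + s t)⁻¹ t ds`, with `κ = ∫₀^∞ s ^ (-p) / (1 + s) ds`,
write `F₃` as a positive superposition of the functions `t₃ (l t₁ + (1 - l) t₂ + s t₃)⁻¹ t₃`. The
latter make sense for noncommuting positive invertible operators, so the same superposition, as a
Bochner integral in `B(H)`, defines the extension `extF₃`.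

Convexity: `(x, y) ↦ x y⁻¹ x` is jointly convex because it is the maximum over `w` of the affine
functions `x w + w⋆ x - w⋆ y w` (`affine_le_mul_inverse_mul`, `convexOn_mul_inverse_mul`). Here `x`
and `y` are linear in the triple, and convexity survives integration (`convexOn_extF₃`).

Agreement with the functional calculus (`extF₃_eq_jointCalculus`): the integral is natural under
continuous homomorphisms of real Banach algebras (`map_integral_fractionKernel`). Evaluating the
integral in the algebra of continuous functions on the product of the spectra gives `F₃`, while the
functional calculus sends it to `extF₃`. Operator convexity then follows, since tuples from mutually
commuting subalgebras have commuting entries.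
-/

open MeasureTheory Set

/-! ### The rational kernel and its integral in a real Banach algebra -/

section Kernel

variable {R S : Type*} [Ring R] [Algebra ℝ R] [Ring S] [Algebra ℝ S]

/-- The linear pencil `l a + (1 - l) b + s c` at the parameter `(l, s)`. -/
def pencil (a b c : R) (z : ℝ × ℝ) : R := z.1 • a + (1 - z.1) • b + z.2 • c

/-- The kernel `s ^ (-p) c (l a + (1 - l) b + s c)⁻¹ c` at the parameter `(l, s)`. The inverse is
`Ring.inverse`, which vanishes at non-units. -/
noncomputable def fractionKernel (p : ℝ) (a b c : R) (z : ℝ × ℝ) : R :=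
  z.2 ^ (-p) • (c * Ring.inverse (pencil a b c z) * c)

/-- The domain of the parameters `(l, s)`. -/
def paramDomain : Set (ℝ × ℝ) := Ioc 0 1 ×ˢ Ioi 0

theorem measurableSet_paramDomain : MeasurableSet paramDomain :=
  measurableSet_Ioc.prod measurableSet_Ioi

theorem map_ringInverse_of_isUnit (φ : R →ₐ[ℝ] S) {a : R} (h : IsUnit a) :
    φ (Ring.inverse a) = Ring.inverse (φ a) := by
  obtain ⟨u, rfl⟩ := h
  have : φ (u : R) = (Units.map (φ : R →* S) u : Sˣ) := rfl
  rw [this, Ring.inverse_unit, Ring.inverse_unit, ← map_inv]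
  rfl

theorem map_pencil (φ : R →ₐ[ℝ] S) (a b c : R) (z : ℝ × ℝ) :
    φ (pencil a b c z) = pencil (φ a) (φ b) (φ c) z := by
  simp [pencil]

theorem map_fractionKernel (φ : R →ₐ[ℝ] S) (p : ℝ) {a b c : R} {z : ℝ × ℝ}
    (h : IsUnit (pencil a b c z)) :
    φ (fractionKernel p a b c z) = fractionKernel p (φ a) (φ b) (φ c) z := by
  simp [fractionKernel, map_ringInverse_of_isUnit φ h, map_pencil]

end Kernel

section Integrability

variable {R S : Type*} [NormedRing R] [NormedAlgebra ℝ R] [CompleteSpace R]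
  [NormedRing S] [NormedAlgebra ℝ S] [CompleteSpace S]

theorem integrableOn_rpow_neg_div_one_add {p : ℝ} (hp0 : 0 < p) (hp1 : p < 1) :
    IntegrableOn (fun s : ℝ => s ^ (-p) * (1 + s)⁻¹) (Ioi 0) := by
  have h : 1 - p ∈ Ioo (0 : ℝ) 1 := ⟨by linarith, by linarith⟩
  refine (Real.integrableOn_rpowIntegrand₀₁_Ioi h zero_le_one).congr_fun ?_ measurableSet_Ioi
  intro t ht
  simp only
  rw [Real.rpowIntegrand₀₁_eq_pow_div h (le_of_lt ht) zero_le_one]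
  rw [show 1 - p - 1 = -p by ring, mul_one, div_eq_mul_inv, add_comm t 1]

/-- The decay of the inverse in `s` makes the kernel dominated by a multiple of
`s ^ (-p) / (1 + s)`, which is integrable as `0 < p < 1`. -/
theorem integrableOn_fractionKernel {p : ℝ} (hp0 : 0 < p) (hp1 : p < 1) {a b c : R} {M : ℝ}
    (hu : ∀ z ∈ paramDomain, IsUnit (pencil a b c z))
    (hM : ∀ z ∈ paramDomain, ‖Ring.inverse (pencil a b c z)‖ ≤ M * (1 + z.2)⁻¹) :
    IntegrableOn (fractionKernel p a b c) paramDomain := by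
  have hdom : IntegrableOn
      (fun z : ℝ × ℝ => (‖c‖ * M * ‖c‖) * (z.2 ^ (-p) * (1 + z.2)⁻¹)) paramDomain := by
    refine Integrable.const_mul ?_ _
    have h1 : Integrable (fun _ : ℝ => (1 : ℝ)) (volume.restrict (Ioc 0 1)) := by simp
    have h2 := h1.mul_prod (integrableOn_rpow_neg_div_one_add hp0 hp1)
    rw [Measure.prod_restrict] at h2
    simp only [one_mul] at h2
    exact h2
  have hcont : ContinuousOn (fractionKernel p a b c) paramDomain := by
    have h1 : ContinuousOn (fun z : ℝ × ℝ => z.2 ^ (-p)) paramDomain :=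
      continuousOn_snd.rpow_const fun z hz => Or.inl (ne_of_gt hz.2)
    have h2 : ContinuousOn (fun z => Ring.inverse (pencil a b c z)) paramDomain := by
      intro z hz
      obtain ⟨u, hu⟩ := hu z hz
      have hi : ContinuousAt Ring.inverse (pencil a b c z) :=
        hu ▸ NormedRing.inverse_continuousAt u
      have hp : Continuous (pencil a b c) := by unfold pencil; fun_prop
      exact (hi.comp hp.continuousAt).continuousWithinAt
    exact h1.smul ((continuousOn_const.mul h2).mul continuousOn_const)
  refine Integrable.mono' hdom (hcont.aestronglyMeasurable measurableSet_paramDomain) ?_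
  filter_upwards [ae_restrict_mem measurableSet_paramDomain] with z hz
  have hz2 : 0 < z.2 := hz.2
  have h1 : ‖c * Ring.inverse (pencil a b c z) * c‖ ≤ ‖c‖ * (M * (1 + z.2)⁻¹) * ‖c‖ :=
    (norm_mul_le _ _).trans <| mul_le_mul_of_nonneg_right
      ((norm_mul_le _ _).trans (mul_le_mul_of_nonneg_left (hM z hz) (norm_nonneg _)))
      (norm_nonneg _)
  calc ‖fractionKernel p a b c z‖
      = z.2 ^ (-p) * ‖c * Ring.inverse (pencil a b c z) * c‖ := by
        rw [fractionKernel, norm_smul, Real.norm_of_nonneg (by positivity)]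
    _ ≤ z.2 ^ (-p) * (‖c‖ * (M * (1 + z.2)⁻¹) * ‖c‖) := by gcongr
    _ = _ := by ring

/-- The integral of `fractionKernel` is natural in the algebra. -/
theorem map_integral_fractionKernel (φ : R →ₐ[ℝ] S) (hφ : Continuous φ) (p : ℝ) {a b c : R}
    (hu : ∀ z ∈ paramDomain, IsUnit (pencil a b c z))
    (hi : IntegrableOn (fractionKernel p a b c) paramDomain) :
    φ (∫ z in paramDomain, fractionKernel p a b c z) =
      ∫ z in paramDomain, fractionKernel p (φ a) (φ b) (φ c) z := by
  let L : R →L[ℝ] S := ⟨φ.toLinearMap, hφ⟩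
  have h := L.integral_comp_comm hi
  refine h.symm.trans ?_
  exact setIntegral_congr_fun measurableSet_paramDomain
    fun z hz => map_fractionKernel φ p (hu z hz)

end Integrability

/-! ### Scalar integral representations -/

section Scalar

theorem pencil_ge {x y t r : ℝ} (hx : r ≤ x) (hy : r ≤ y) (ht : r ≤ t)
    {z : ℝ × ℝ} (hz : z ∈ paramDomain) : r * (1 + z.2) ≤ pencil x y t z := by
  obtain ⟨⟨h0, h1⟩, h2⟩ := hz
  have h2 : 0 < z.2 := h2
  simp only [pencil, smul_eq_mul]
  nlinarith [mul_le_mul_of_nonneg_left hx h0.le, mul_le_mul_of_nonneg_left hy (sub_nonneg.2 h1),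
    mul_le_mul_of_nonneg_left ht h2.le]

theorem pencil_pos {x y t : ℝ} (hx : 0 < x) (hy : 0 < y) (ht : 0 < t)
    {z : ℝ × ℝ} (hz : z ∈ paramDomain) : 0 < pencil x y t z := by
  have hr : 0 < min x (min y t) := by positivity
  have h2 : 0 < z.2 := hz.2
  refine lt_of_lt_of_le (by positivity)
    (pencil_ge (r := min x (min y t)) (by simp) (by simp) (by simp) hz)

/-- The normalizing constant `∫₀^∞ s ^ (-p) / (1 + s) ds`, written with Mathlib's integrand for the
power `1 - p`. -/
noncomputable def rpowConst (p : ℝ) : ℝ := ∫ t in Ioi 0, Real.rpowIntegrand₀₁ (1 - p) t 1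

theorem rpowConst_pos {p : ℝ} (hp0 : 0 < p) (hp1 : p < 1) : 0 < rpowConst p :=
  Real.integral_rpowIntegrand₀₁_one_pos ⟨by linarith, by linarith⟩

/-- The perspective `t (m / t) ^ (-p) = m ^ (-p) t ^ (1 + p)` of the power function as a
superposition of the functions `t ^ 2 / (m + s t)`. -/
theorem integral_rpow_neg_mul_sq_div {p m t : ℝ} (hp0 : 0 < p) (hp1 : p < 1) (hm : 0 < m)
    (ht : 0 < t) :
    ∫ s in Ioi 0, s ^ (-p) * (t * (m + s * t)⁻¹ * t) = rpowConst p * (m ^ (-p) * t ^ (1 + p)) := by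
  have h : 1 - p ∈ Ioo (0 : ℝ) 1 := ⟨by linarith, by linarith⟩
  have hmt : 0 < m / t := by positivity
  have key : ∀ s ∈ Ioi (0 : ℝ), s ^ (-p) * (t * (m + s * t)⁻¹ * t) =
      (t ^ 2 / m) * Real.rpowIntegrand₀₁ (1 - p) s (m / t) := by
    intro s hs
    have hs : 0 < s := hs
    rw [Real.rpowIntegrand₀₁_eq_pow_div h hs.le hmt.le, show 1 - p - 1 = -p by ring]
    have : 0 < m + s * t := by positivity
    have : 0 < s * t + m := by positivity
    field_simp
    ring
  rw [setIntegral_congr_fun measurableSet_Ioi key, integral_const_mul,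
    Real.integral_rpowIntegrand₀₁_eq_rpow_mul_const h hmt.le, ← rpowConst,
    Real.div_rpow hm.le ht.le, Real.rpow_sub hm, Real.rpow_sub ht, Real.rpow_neg hm.le,
    Real.rpow_add ht, Real.rpow_one, Real.rpow_one]
  have : 0 < m ^ p := by positivity
  have : 0 < t ^ p := by positivity
  field_simp

/-- For `x, y > 0`, the difference quotient of `t ^ (1 - p)` is the mean of its derivative over the
segment. -/
theorem integral_segment_rpow_neg {p x y : ℝ} (hp1 : p < 1) :
    (1 - p) * ∫ l in (0 : ℝ)..1, (l * x + (1 - l) * y) ^ (-p) =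
      if x = y then (1 - p) * x ^ (-p) else (x ^ (1 - p) - y ^ (1 - p)) / (x - y) := by
  split_ifs with hxy
  · subst hxy
    have : ∀ l : ℝ, l * x + (1 - l) * x = x := fun l => by ring
    simp [this]
  · have h1 : ∀ l : ℝ, l * x + (1 - l) * y = (x - y) * l + y := fun l => by ring
    have hne : x - y ≠ 0 := sub_ne_zero.2 hxy
    simp only [h1]
    rw [intervalIntegral.integral_comp_mul_add (fun u => u ^ (-p)) hne y]
    rw [integral_rpow (Or.inl (by linarith))]
    have : 1 - p ≠ 0 := by linarith
    simp only [mul_zero, zero_add, mul_one, sub_add_cancel, smul_eq_mul, neg_add_eq_sub]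
    field_simp

theorem integral_fractionKernel_real {p : ℝ} (hp0 : 0 < p) (hp1 : p < 1) {x y t : ℝ}
    (hx : 0 < x) (hy : 0 < y) (ht : 0 < t)
    (hi : IntegrableOn (fractionKernel p x y t) paramDomain) :
    ∫ z in paramDomain, fractionKernel p x y t z =
      rpowConst p * ((∫ l in (0 : ℝ)..1, (l * x + (1 - l) * y) ^ (-p)) * t ^ (1 + p)) := by
  rw [paramDomain, Measure.volume_eq_prod, setIntegral_prod _ hi]
  rw [intervalIntegral.integral_of_le zero_le_one, ← integral_mul_const, ← integral_const_mul]
  refine setIntegral_congr_fun measurableSet_Ioc fun l hl => ?_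
  have hm : 0 < l * x + (1 - l) * y := by
    have := hl.1
    have := sub_nonneg.2 hl.2
    nlinarith [mul_pos hl.1 hx, mul_nonneg this hy.le]
  simpa [fractionKernel, pencil] using integral_rpow_neg_mul_sq_div hp0 hp1 hm ht

theorem F₃_eq_integral {p : ℝ} (hp0 : 0 < p) (hp1 : p < 1) {t : Fin 3 → ℝ} (ht : ∀ i, 0 < t i)
    (hi : IntegrableOn (fractionKernel p (t 0) (t 1) (t 2)) paramDomain) :
    F₃ p t = ((1 - p) / rpowConst p) *
      ∫ z in paramDomain, fractionKernel p (t 0) (t 1) (t 2) z := by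
  have hc := (rpowConst_pos hp0 hp1).ne'
  have h := integral_segment_rpow_neg (x := t 0) (y := t 1) hp1
  have hF : F₃ p t = (if t 0 = t 1 then (1 - p) * t 0 ^ (-p) else
      (t 0 ^ (1 - p) - t 1 ^ (1 - p)) / (t 0 - t 1)) * t 2 ^ (1 + p) := by
    rw [F₃, ite_mul]
  rw [hF, ← h, integral_fractionKernel_real hp0 hp1 (ht 0) (ht 1) (ht 2) hi]
  rw [← mul_assoc ((1 - p) / rpowConst p), div_mul_cancel₀ _ hc, mul_assoc]

end Scalar

/-! ### Convexity of the extension in a `C⋆`-algebra -/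

section Operators

variable {A : Type*} [CStarAlgebra A] [PartialOrder A] [StarOrderedRing A]

/-- Any `w` gives an affine minorant of `(x, y) ↦ x y⁻¹ x`, by expanding the nonnegative
`(x - y w)⋆ y⁻¹ (x - y w)`. -/
theorem affine_le_mul_inverse_mul {x y : A} (hx : IsSelfAdjoint x) (hy : IsStrictlyPositive y)
    (w : A) : x * w + star w * x - star w * y * w ≤ x * Ring.inverse y * x := by
  have h := star_left_conjugate_nonneg (hy.ringInverse).nonneg (x - y * w)
  have h1 := Ring.inverse_mul_cancel y hy.isUnit
  have h2 := Ring.mul_inverse_cancel y hy.isUnit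
  rw [← sub_nonneg]
  convert h using 1
  have e1 : Ring.inverse y * (y * w) = w := by rw [← mul_assoc, h1, one_mul]
  have e2 : star w * y * Ring.inverse y = star w := by rw [mul_assoc, h2, mul_one]
  simp only [star_sub, star_mul, hx.star_eq, hy.isSelfAdjoint.star_eq, sub_mul, mul_sub]
  simp only [mul_assoc] at *
  simp only [e1]
  simp only [← mul_assoc] at *
  simp only [e2]
  abel

theorem convex_isStrictlyPositive : Convex ℝ {a : A | IsStrictlyPositive a} := by
  intro a ha b hb s t hs ht hst
  rcases hs.eq_or_lt with rfl | hs
  · obtain rfl : t = 1 := by linarith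
    simpa using hb
  · exact (IsStrictlyPositive.smul hs ha).add_nonneg (smul_nonneg ht hb.nonneg)

/-- Joint convexity of `(x, y) ↦ x y⁻¹ x`: it is the supremum of affine functions, attained at
`w = y⁻¹ x`. -/
theorem convexOn_mul_inverse_mul :
    ConvexOn ℝ {q : A × A | IsSelfAdjoint q.1 ∧ IsStrictlyPositive q.2}
      (fun q => q.1 * Ring.inverse q.2 * q.1) := by
  have hconv : Convex ℝ {q : A × A | IsSelfAdjoint q.1 ∧ IsStrictlyPositive q.2} := by
    intro q hq r hr s t hs ht hst
    refine ⟨?_, convex_isStrictlyPositive hq.2 hr.2 hs ht hst⟩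
    exact ((IsSelfAdjoint.all s).smul hq.1).add ((IsSelfAdjoint.all t).smul hr.1)
  refine ⟨hconv, ?_⟩
  intro q hq r hr s t hs ht hst
  obtain ⟨hx, hy⟩ := hconv hq hr hs ht hst
  set v := s • q + t • r with hv
  set w := Ring.inverse v.2 * v.1 with hw
  have hq' := smul_le_smul_of_nonneg_left (affine_le_mul_inverse_mul hq.1 hq.2 w) hs
  have hr' := smul_le_smul_of_nonneg_left (affine_le_mul_inverse_mul hr.1 hr.2 w) ht
  refine le_trans (le_of_eq ?_) (add_le_add hq' hr')
  have e : s • (q.1 * w + star w * q.1 - star w * q.2 * w) +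
      t • (r.1 * w + star w * r.1 - star w * r.2 * w) =
      v.1 * w + star w * v.1 - star w * v.2 * w := by
    simp only [hv, Prod.fst_add, Prod.snd_add, Prod.smul_fst, Prod.smul_snd, mul_add, add_mul,
      smul_mul_assoc, mul_smul_comm, smul_add, smul_sub]
    abel
  rw [e]
  have e2 : v.2 * w = v.1 := by
    rw [hw, ← mul_assoc, Ring.mul_inverse_cancel _ hy.isUnit, one_mul]
  rw [mul_assoc (star w), e2, add_sub_cancel_right, hw]
  exact mul_assoc _ _ _

theorem isStrictlyPositive_pencil {a b c : A} (ha : IsStrictlyPositive a)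
    (hb : IsStrictlyPositive b) (hc : IsStrictlyPositive c) {z : ℝ × ℝ} (hz : z ∈ paramDomain) :
    IsStrictlyPositive (pencil a b c z) :=
  (convex_isStrictlyPositive ha hb hz.1.1.le (sub_nonneg.2 hz.1.2) (by ring)).add_nonneg
    (smul_nonneg (le_of_lt hz.2) hc.nonneg)

theorem exists_pos_algebraMap_le {a : A} (ha : IsStrictlyPositive a) :
    ∃ r : ℝ, 0 < r ∧ algebraMap ℝ A r ≤ a := by
  rcases subsingleton_or_nontrivial A with h | h
  · exact ⟨1, one_pos, (Subsingleton.elim _ _).le⟩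
  · exact (CFC.exists_pos_algebraMap_le_iff ha.isSelfAdjoint).2 fun x hx => ha.spectrum_pos hx

theorem norm_inverse_pencil_le {a b c : A} {r : ℝ} (hr : 0 < r) (ha : algebraMap ℝ A r ≤ a)
    (hb : algebraMap ℝ A r ≤ b) (hc : algebraMap ℝ A r ≤ c) {z : ℝ × ℝ} (hz : z ∈ paramDomain) :
    ‖Ring.inverse (pencil a b c z)‖ ≤ r⁻¹ * (1 + z.2)⁻¹ := by
  have h2 : 0 < z.2 := hz.2
  have hpos : 0 < r * (1 + z.2) := by positivity
  have hlow : algebraMap ℝ A (r * (1 + z.2)) ≤ pencil a b c z := by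
    have h := add_le_add (add_le_add (smul_le_smul_of_nonneg_left ha hz.1.1.le)
      (smul_le_smul_of_nonneg_left hb (sub_nonneg.2 hz.1.2)))
      (smul_le_smul_of_nonneg_left hc h2.le)
    refine le_trans (le_of_eq ?_) h
    simp only [Algebra.algebraMap_eq_smul_one, smul_smul, ← add_smul]
    congr 1
    ring
  have hsp : IsStrictlyPositive (algebraMap ℝ A (r * (1 + z.2))) :=
    isStrictlyPositive_algebraMap hpos
  have hinv := CStarAlgebra.ringInverse_le_ringInverse hlow hsp
  have hP := (hsp.of_le hlow).ringInverse
  rw [← mul_inv, CStarAlgebra.norm_le_iff_le_algebraMap _ (by positivity) hP.nonneg]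
  refine hinv.trans (le_of_eq ?_)
  have := map_ringInverse_of_isUnit (Algebra.ofId ℝ A) (IsUnit.mk0 _ hpos.ne')
  rw [Ring.inverse_eq_inv'] at this
  exact this.symm

theorem integrableOn_fractionKernel_of_isStrictlyPositive {p : ℝ} (hp0 : 0 < p) (hp1 : p < 1)
    {a b c : A} (ha : IsStrictlyPositive a) (hb : IsStrictlyPositive b)
    (hc : IsStrictlyPositive c) : IntegrableOn (fractionKernel p a b c) paramDomain := by
  obtain ⟨r, hr, hra⟩ := exists_pos_algebraMap_le ha
  obtain ⟨s, hs, hsb⟩ := exists_pos_algebraMap_le hb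
  obtain ⟨t, ht, htc⟩ := exists_pos_algebraMap_le hc
  have hm : 0 < min r (min s t) := by positivity
  refine integrableOn_fractionKernel hp0 hp1 (M := (min r (min s t))⁻¹)
    (fun z hz => (isStrictlyPositive_pencil ha hb hc hz).isUnit)
    fun z hz => norm_inverse_pencil_le hm ?_ ?_ ?_ hz
  · exact (algebraMap_mono A (by simp)).trans hra
  · exact (algebraMap_mono A (by simp)).trans hsb
  · exact (algebraMap_mono A (by simp)).trans htc

theorem convexOn_fractionKernel (p : ℝ) {z : ℝ × ℝ} (hz : z ∈ paramDomain) :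
    ConvexOn ℝ {X : Fin 3 → A | ∀ i, IsStrictlyPositive (X i)}
      (fun X => fractionKernel p (X 0) (X 1) (X 2) z) := by
  let L : (Fin 3 → A) →ₗ[ℝ] A × A :=
    { toFun := fun X => (X 2, pencil (X 0) (X 1) (X 2) z)
      map_add' := fun X Y => by
        ext <;> simp only [pencil, Pi.add_apply, smul_add, Prod.mk_add_mk]
        abel
      map_smul' := fun s X => by
        ext <;> simp [pencil, smul_add, smul_comm s] }
  have hz2 : 0 < z.2 := hz.2
  have hset : Convex ℝ {X : Fin 3 → A | ∀ i, IsStrictlyPositive (X i)} :=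
    fun X hX Y hY s t hs ht hst i => convex_isStrictlyPositive (hX i) (hY i) hs ht hst
  have h := (convexOn_mul_inverse_mul (A := A)).comp_linearMap L
  refine ConvexOn.smul (by positivity) (h.subset (fun X hX => ?_) hset)
  exact ⟨(hX 2).isSelfAdjoint, isStrictlyPositive_pencil (hX 0) (hX 1) (hX 2) hz⟩

variable (A) in
/-- The extension of `F₃ p` to triples of positive invertible elements of a `C⋆`-algebra. -/
noncomputable def extF₃ (p : ℝ) (X : Fin 3 → A) : A :=
  ((1 - p) / rpowConst p) • ∫ z in paramDomain, fractionKernel p (X 0) (X 1) (X 2) z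

theorem convexOn_extF₃ {p : ℝ} (hp0 : 0 < p) (hp1 : p < 1) :
    ConvexOn ℝ {X : Fin 3 → A | ∀ i, IsStrictlyPositive (X i)} (extF₃ A p) := by
  refine ConvexOn.smul (div_nonneg (by linarith) (rpowConst_pos hp0 hp1).le) ?_
  refine integral_convexOn_of_integrand_ae ?_ ?_ ?_
  · exact fun X hX Y hY s t hs ht hst i => convex_isStrictlyPositive (hX i) (hY i) hs ht hst
  · filter_upwards [ae_restrict_mem measurableSet_paramDomain] with z hz
    exact convexOn_fractionKernel p hz
  · exact fun X hX =>
      integrableOn_fractionKernel_of_isStrictlyPositive hp0 hp1 (hX 0) (hX 1) (hX 2)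

theorem extF₃_nonneg {p : ℝ} (hp0 : 0 < p) (hp1 : p < 1) {X : Fin 3 → A}
    (hX : ∀ i, IsStrictlyPositive (X i)) : 0 ≤ extF₃ A p X := by
  refine smul_nonneg (div_nonneg (by linarith) (rpowConst_pos hp0 hp1).le) ?_
  refine integral_nonneg_of_ae ?_
  filter_upwards [ae_restrict_mem measurableSet_paramDomain] with z hz
  have hz2 : 0 < z.2 := hz.2
  have h := star_left_conjugate_nonneg
    (isStrictlyPositive_pencil (hX 0) (hX 1) (hX 2) hz).ringInverse.nonneg (X 2)
  rw [(hX 2).isSelfAdjoint.star_eq] at h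
  exact smul_nonneg (by positivity) h

end Operators

/-! ### Agreement with the joint functional calculus -/

section FunctionalCalculus

variable {H : Type u} [NormedAddCommGroup H] [InnerProductSpace ℂ H] [CompleteSpace H]

/-- On commuting triples the extension is the functional calculus: the integral defining it is the
image under the calculus of the same integral in the algebra of continuous functions on the product
of the spectra. -/
theorem extF₃_eq_jointCalculus {p : ℝ} (hp0 : 0 < p) (hp1 : p < 1)
    {X : Fin 3 → H →L[ℂ] H} (hX : ∀ i, IsStrictlyPositive (X i))
    (hc : ∀ i j, Commute (X i) (X j)) :
    extF₃ (H →L[ℂ] H) p X = jointCalculus (F₃ p) X := by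
  obtain ⟨Ψ, hΨ⟩ := exists_isJointCalculus X (fun i => (hX i).isSelfAdjoint) hc
  have : CompactSpace (spectralBox X) := isCompact_iff_compactSpace.mp (spectralBox_isCompact X)
  -- a common positive lower bound for the spectra
  obtain ⟨r, hr, hrX⟩ : ∃ r : ℝ, 0 < r ∧ ∀ i, ∀ x ∈ spectrum ℝ (X i), r ≤ x := by
    choose s hs hsX using fun i => exists_pos_algebraMap_le (hX i)
    refine ⟨min (s 0) (min (s 1) (s 2)), by simp [hs], fun i x hx => ?_⟩
    have := (algebraMap_le_iff_le_spectrum (a := X i) (hX i).isSelfAdjoint).1 (hsX i) x hx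
    refine le_trans ?_ this
    fin_cases i <;> simp
  set e : Fin 3 → C(spectralBox X, ℝ) := spectralCoord X with he
  have hr' : ∀ (x : spectralBox X) i, r ≤ e i x := fun x i => hrX i _ (x.2 i (mem_univ i))
  let ev : spectralBox X → (C(spectralBox X, ℝ) →ₐ[ℝ] ℝ) := fun x => ContinuousMap.evalAlgHom ℝ ℝ x
  have hev : ∀ x, Continuous (ev x) := fun x => continuous_eval_const x
  have hge : ∀ z ∈ paramDomain, ∀ x, r * (1 + z.2) ≤ pencil (e 0) (e 1) (e 2) z x := by
    intro z hz x
    have h := pencil_ge (hr' x 0) (hr' x 1) (hr' x 2) hz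
    exact h.trans (map_pencil (ev x) (e 0) (e 1) (e 2) z).ge
  have hz0 : ∀ z ∈ paramDomain, 0 < r * (1 + z.2) := fun z hz =>
    mul_pos hr (add_pos one_pos hz.2)
  have hu : ∀ z ∈ paramDomain, IsUnit (pencil (e 0) (e 1) (e 2) z) := fun z hz =>
    ContinuousMap.isUnit_iff_forall_ne_zero _ |>.2 fun x =>
      ((hz0 z hz).trans_le (hge z hz x)).ne'
  have hi : IntegrableOn (fractionKernel p (e 0) (e 1) (e 2)) paramDomain := by
    refine integrableOn_fractionKernel hp0 hp1 (M := r⁻¹) hu fun z hz => ?_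
    rw [← mul_inv, ContinuousMap.norm_le _ (inv_nonneg.2 (hz0 z hz).le)]
    intro x
    have h1 : Ring.inverse (pencil (e 0) (e 1) (e 2) z) x =
        (pencil (e 0) (e 1) (e 2) z x)⁻¹ := by
      rw [← Ring.inverse_eq_inv']
      exact map_ringInverse_of_isUnit (ev x) (hu z hz)
    have h2 := hge z hz x
    have h3 := (hz0 z hz).trans_le h2
    rw [h1, Real.norm_of_nonneg (inv_nonneg.2 h3.le)]
    exact inv_anti₀ (hz0 z hz) h2
  -- the integral in the algebra of continuous functions; its values are those of `F₃ p`
  set G : C(spectralBox X, ℝ) :=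
    ((1 - p) / rpowConst p) • ∫ z in paramDomain, fractionKernel p (e 0) (e 1) (e 2) z with hG
  have hFG : ∀ x : spectralBox X, F₃ p x.1 = G x := by
    intro x
    have hpos : ∀ i, 0 < x.1 i := fun i => hr.trans_le (hr' x i)
    have h1 := map_integral_fractionKernel (ev x) (hev x) p hu hi
    rw [F₃_eq_integral hp0 hp1 hpos]
    · exact congrArg (((1 - p) / rpowConst p) * ·) h1.symm
    · have h3 := (⟨(ev x).toLinearMap, hev x⟩ : C(spectralBox X, ℝ) →L[ℝ] ℝ).integrable_comp hi
      refine IntegrableOn.congr_fun h3 (fun z hz => ?_) measurableSet_paramDomain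
      exact map_fractionKernel (ev x) p (hu z hz)
  have hcont : ContinuousOn (F₃ p) (spectralBox X) := by
    rw [continuousOn_iff_continuous_domRestrict]
    exact (map_continuous G).congr fun x => (hFG x).symm
  rw [hΨ.jointCalculus_eq hcont]
  have hGeq : (⟨(spectralBox X).domRestrict (F₃ p), hcont.domRestrict⟩ :
      C(spectralBox X, ℝ)) = G := ContinuousMap.ext hFG
  rw [hGeq, hG, map_smul, extF₃]
  have h := map_integral_fractionKernel (Ψ : C(spectralBox X, ℝ) →ₐ[ℝ] (H →L[ℂ] H)) hΨ.1 p hu hi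
  congr 1
  refine Eq.trans ?_ h.symm
  simp only [he, StarAlgHom.coe_toAlgHom, hΨ.2]

end FunctionalCalculus

theorem mainTheorem7 (p : ℝ) (hp0 : 0 < p) (hp1 : p < 1) :
    (∀ (H : Type u) [NormedAddCommGroup H] [InnerProductSpace ℂ H] [CompleteSpace H],
      ∃ Φ : (Fin 3 → H →L[ℂ] H) → H →L[ℂ] H,
        IsOperatorExtension (F₃ p) Φ ∧ ConvexOn ℝ (posDefTuples 3 H) Φ) ∧
    IsOperatorConvex.{u} (fun _ : Fin 3 => Set.Ioi 0) (F₃ p) := by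
  refine ⟨fun H _ _ _ => ⟨extF₃ (H →L[ℂ] H) p, ⟨fun X hX => ?_, fun X hX hc => ?_⟩, ?_⟩, ?_⟩
  · exact (extF₃_nonneg hp0 hp1 hX).isSelfAdjoint
  · exact extF₃_eq_jointCalculus hp0 hp1 hX hc
  · exact convexOn_extF₃ hp0 hp1
  · intro H _ _ _ 𝒜 _ hcomm
    have hpos : ∀ a : H →L[ℂ] H, IsSelfAdjoint a ∧ spectrum ℝ a ⊆ Ioi 0 ↔
        IsStrictlyPositive a := fun a =>
      ⟨fun h => (StarOrderedRing.isStrictlyPositive_iff_spectrum_pos a h.1).2 fun x hx => h.2 hx,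
        fun h => ⟨h.isSelfAdjoint, fun x hx => h.spectrum_pos hx⟩⟩
    -- the domain in the definition of operator convexity consists of strictly positive elements
    simp only [hpos]
    have hconv : Convex ℝ {X : Fin 3 → H →L[ℂ] H | ∀ i, X i ∈ 𝒜 i ∧ IsStrictlyPositive (X i)} := by
      intro X hX Y hY s t hs ht hst i
      refine ⟨?_, convex_isStrictlyPositive (hX i).2 (hY i).2 hs ht hst⟩
      have hsmul : ∀ (s : ℝ) (a : H →L[ℂ] H), a ∈ 𝒜 i → s • a ∈ 𝒜 i := fun s a ha => by
        -- `𝒜 i` is a complex subalgebra, so real scalars are passed through `ℂ`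
        rw [← Complex.coe_smul]
        exact SMulMemClass.smul_mem (s : ℂ) ha
      exact add_mem (hsmul s _ (hX i).1) (hsmul t _ (hY i).1)
    refine ((convexOn_extF₃ hp0 hp1).subset (fun X hX i => (hX i).2) hconv).congr
      fun X hX => extF₃_eq_jointCalculus hp0 hp1 (fun i => (hX i).2) fun i j => ?_
    rcases eq_or_ne i j with rfl | hij
    · exact Commute.refl _
    · exact hcomm i j hij _ (hX i).1 _ (hX j).1
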